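/- Call a Lie subalgebra $\mathfrak g\subseteq gl(n,\mathbb C)$ (with the commutator bracket) \emph{algebraic} if it is the Lie algebra (the tangent space at the identity) of an algebraic subgroup of $GL(n,\mathbb C)$, i.e. of a subgroup cut out in $GL(n,\mathbb C)$ by polynomial equations in the matrix entries. A \emph{replica} of $X\in gl(n,\mathbb C)$ is a matrix that belongs to every algebraic Lie subalgebra of $gl(n,\mathbb C)$ containing $X$. Let $\alpha,\beta\in\mathbb C$, let $$\mathfrak h_{\alpha,\beta}=\left\{\begin{pmatrix} x_1+x_2 & x_1+x_2 & 0 & x_1\\ x_1+x_2 & x_1+x_2 & 0 & x_2\\ \alpha x_1+(\beta-1)x_2 & \beta x_1+(\alpha+1)x_2 & 0 & x_3\\ 0&0&0&0\end{pmatrix} : x_1,x_2,x_3\in\mathbb C\right\},\qquad X_4=\begin{pmatrix}1&1&0&\frac12\\ 1&1&0&\frac12\\ \frac{\alpha+\beta}2&\frac{\alpha+\beta}2&0&\frac{\alpha+\beta}4\\ 0&0&0&0\end{pmatrix},$$ and let $\mathfrak m\subseteq gl(4,\mathbb C)$ be the Lie algebra of all matrices $$\begin{pmatrix} x_1+x_2+x_4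 & x_1+x_2+x_4 & 0 & x_1+\frac{x_4}2\\ x_1+x_2+x_4 & x_1+x_2+x_4 & 0 & x_2+\frac{x_4}2\\ \alpha x_1+(\beta-1)x_2+\frac{\alpha+\beta}2x_4 & \beta x_1+(\alpha+1)x_2+\frac{\alpha+\beta}2x_4 & 0 & x_3+\frac{\alpha+\beta}4x_4\\ 0&0&0&0\end{pmatrix},\qquad x_1,x_2,x_3,x_4\in\mathbb C.$$ Then $\mathfrak m=\mathfrak h_{\alpha,\beta}\oplus\mathbb C X_4$ is $4$-dimensional, and $\mathfrak m$ is algebraic. It is the algebraic Lie algebra generated by $\mathfrak h_{\alpha,\beta}$: it is the smallest algebraic Lie subalgebra of $gl(4,\mathbb C)$ containing $\mathfrak h_{\alpha,\beta}$, and $[\mathfrak m,\mathfrak m]=[\mathfrak h_{\alpha,\beta},\mathfrak h_{\alpha,\beta}]$. Moreover $\mathfrak m$ contains all replicas of each of its elements. -/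

import Mathlib

open Matrix

-- `gl(n, ℂ)`: the Lie bracket of matrices is the commutator
attribute [local instance 100] LieRing.ofAssociativeRing

/-- The matrix entries of `g`, viewed as a point of the affine space `ℂ^(n × n)`. -/
def matrixPoint {n : ℕ} (g : Matrix (Fin n) (Fin n) ℂ) : Fin n × Fin n → ℂ :=
  fun ij => g ij.1 ij.2

/-- A linear algebraic group: a subgroup of `GL(n, ℂ)` that is cut out in `GL(n, ℂ)` by
polynomial equations in the matrix entries. -/
def IsAlgebraicSubgroup {n : ℕ} (G : Subgroup (GL (Fin n) ℂ)) : Prop :=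
  ∃ I : Ideal (MvPolynomial (Fin n × Fin n) ℂ),
    ∀ g : GL (Fin n) ℂ, g ∈ G ↔ matrixPoint g.val ∈ MvPolynomial.zeroLocus ℂ I

/-- The ideal of all polynomials in the matrix entries that vanish on `G`. -/
noncomputable def groupIdeal {n : ℕ} (G : Subgroup (GL (Fin n) ℂ)) :
    Ideal (MvPolynomial (Fin n × Fin n) ℂ) :=
  MvPolynomial.vanishingIdeal ℂ
    ((fun g : GL (Fin n) ℂ => matrixPoint g.val) '' (G : Set (GL (Fin n) ℂ)))

/-- The space underlying the Lie algebra of `G`, as a subspace of `gl(n, ℂ)`: the tangent space at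
the identity, that is, the matrices `X` such that the differential at `1` of every polynomial
vanishing on `G` kills `X`. -/
noncomputable def groupTangentSpace {n : ℕ} (G : Subgroup (GL (Fin n) ℂ)) :
    Submodule ℂ (Matrix (Fin n) (Fin n) ℂ) where
  carrier := {X | ∀ p ∈ groupIdeal G,
    ∑ ij : Fin n × Fin n,
      MvPolynomial.eval (matrixPoint 1) (MvPolynomial.pderiv ij p) * X ij.1 ij.2 = 0}
  zero_mem' := by
    intro p _
    simp
  add_mem' := by
    intro X Y hX hY p hp
    simp only [Matrix.add_apply, mul_add, Finset.sum_add_distrib]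
    rw [hX p hp, hY p hp, add_zero]
  smul_mem' := by
    intro c X hX p hp
    simp only [Matrix.smul_apply, smul_eq_mul, mul_left_comm _ c, ← Finset.mul_sum]
    rw [hX p hp, mul_zero]

/-- A linear Lie algebra `g ⊆ gl(n, ℂ)` is algebraic if it is the Lie algebra of an algebraic
subgroup of `GL(n, ℂ)`. -/
def IsAlgebraicLie {n : ℕ} (g : LieSubalgebra ℂ (Matrix (Fin n) (Fin n) ℂ)) : Prop :=
  ∃ G : Subgroup (GL (Fin n) ℂ), IsAlgebraicSubgroup G ∧ g.toSubmodule = groupTangentSpace G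

/-- `Y` is a replica of `X`: it lies in the smallest algebraic Lie subalgebra of `gl(n, ℂ)`
containing `X`, that is, in every algebraic Lie subalgebra containing `X`. -/
def IsReplica {n : ℕ} (X Y : Matrix (Fin n) (Fin n) ℂ) : Prop :=
  ∀ g : LieSubalgebra ℂ (Matrix (Fin n) (Fin n) ℂ), IsAlgebraicLie g → X ∈ g → Y ∈ g

/-- The derived algebra `[g, g]`: the span of all brackets of elements of `g`. -/
def derivedSpan {n : ℕ} (g : LieSubalgebra ℂ (Matrix (Fin n) (Fin n) ℂ)) :
    Submodule ℂ (Matrix (Fin n) (Fin n) ℂ) :=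
  Submodule.span ℂ {Z | ∃ X ∈ g, ∃ Y ∈ g, ⁅X, Y⁆ = Z}

/-- The general element of `h_{α,β}`. -/
def hMat (α β x₁ x₂ x₃ : ℂ) : Matrix (Fin 4) (Fin 4) ℂ :=
  !![x₁ + x₂, x₁ + x₂, 0, x₁;
     x₁ + x₂, x₁ + x₂, 0, x₂;
     α * x₁ + (β - 1) * x₂, β * x₁ + (α + 1) * x₂, 0, x₃;
     0, 0, 0, 0]

/-- The matrix `X₄`. -/
noncomputable def matX₄ (α β : ℂ) : Matrix (Fin 4) (Fin 4) ℂ :=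
  !![1, 1, 0, 1 / 2;
     1, 1, 0, 1 / 2;
     (α + β) / 2, (α + β) / 2, 0, (α + β) / 4;
     0, 0, 0, 0]

/-- The general element of `m`. -/
noncomputable def mMat (α β x₁ x₂ x₃ x₄ : ℂ) : Matrix (Fin 4) (Fin 4) ℂ :=
  !![x₁ + x₂ + x₄, x₁ + x₂ + x₄, 0, x₁ + x₄ / 2;
     x₁ + x₂ + x₄, x₁ + x₂ + x₄, 0, x₂ + x₄ / 2;
     α * x₁ + (β - 1) * x₂ + (α + β) / 2 * x₄, β * x₁ + (α + 1) * x₂ + (α + β) / 2 * x₄, 0,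
       x₃ + (α + β) / 4 * x₄;
     0, 0, 0, 0]

/-- The linear Lie algebra `h_{α,β} ⊆ gl(4, ℂ)`. -/
def hAlg (α β : ℂ) : LieSubalgebra ℂ (Matrix (Fin 4) (Fin 4) ℂ) where
  carrier := {A | ∃ x₁ x₂ x₃ : ℂ, A = hMat α β x₁ x₂ x₃}
  zero_mem' := ⟨0, 0, 0, by
    ext i j
    fin_cases i <;> fin_cases j <;> simp [hMat]⟩
  add_mem' := by
    rintro _ _ ⟨x₁, x₂, x₃, rfl⟩ ⟨y₁, y₂, y₃, rfl⟩
    refine ⟨x₁ + y₁, x₂ + y₂, x₃ + y₃, ?_⟩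
    ext i j
    fin_cases i <;> fin_cases j <;> simp [hMat] <;> ring
  smul_mem' := by
    rintro c _ ⟨x₁, x₂, x₃, rfl⟩
    refine ⟨c * x₁, c * x₂, c * x₃, ?_⟩
    ext i j
    fin_cases i <;> fin_cases j <;> simp [hMat] <;> ring
  lie_mem' := by
    rintro _ _ ⟨x₁, x₂, x₃, rfl⟩ ⟨y₁, y₂, y₃, rfl⟩
    refine ⟨0, 0, x₁ * y₂ - x₂ * y₁, ?_⟩
    rw [Ring.lie_def]
    ext i j
    fin_cases i <;> fin_cases j <;>
      simp [hMat] <;> ring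

/-- The linear Lie algebra `m ⊆ gl(4, ℂ)`. -/
noncomputable def mAlg (α β : ℂ) : LieSubalgebra ℂ (Matrix (Fin 4) (Fin 4) ℂ) where
  carrier := {A | ∃ x₁ x₂ x₃ x₄ : ℂ, A = mMat α β x₁ x₂ x₃ x₄}
  zero_mem' := ⟨0, 0, 0, 0, by
    ext i j
    fin_cases i <;> fin_cases j <;> simp [mMat]⟩
  add_mem' := by
    rintro _ _ ⟨x₁, x₂, x₃, x₄, rfl⟩ ⟨y₁, y₂, y₃, y₄, rfl⟩
    refine ⟨x₁ + y₁, x₂ + y₂, x₃ + y₃, x₄ + y₄, ?_⟩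
    ext i j
    fin_cases i <;> fin_cases j <;> simp [mMat] <;> ring
  smul_mem' := by
    rintro c _ ⟨x₁, x₂, x₃, x₄, rfl⟩
    refine ⟨c * x₁, c * x₂, c * x₃, c * x₄, ?_⟩
    ext i j
    fin_cases i <;> fin_cases j <;> simp [mMat] <;> ring
  lie_mem' := by
    rintro _ _ ⟨x₁, x₂, x₃, x₄, rfl⟩ ⟨y₁, y₂, y₃, y₄, rfl⟩
    refine ⟨0, 0, x₁ * y₂ - x₂ * y₁, 0, ?_⟩
    rw [Ring.lie_def]
    ext i j
    fin_cases i <;> fin_cases j <;>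
      simp [mMat] <;> ring

/-! ### Polynomials along curves and lines of matrices. -/

section Curves

variable {n : ℕ}

/-- The chain rule for a polynomial in the matrix entries along a curve of matrices. -/
theorem hasDerivAt_eval_matrixPoint (p : MvPolynomial (Fin n × Fin n) ℂ)
    {γ : ℂ → Matrix (Fin n) (Fin n) ℂ} {V : Matrix (Fin n) (Fin n) ℂ} {t : ℂ}
    (h : ∀ i j, HasDerivAt (fun z => γ z i j) (V i j) t) :
    HasDerivAt (fun z => MvPolynomial.eval (matrixPoint (γ z)) p)
      (∑ ij : Fin n × Fin n,
        MvPolynomial.eval (matrixPoint (γ t)) (MvPolynomial.pderiv ij p) * V ij.1 ij.2) t := by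
  induction p using MvPolynomial.induction_on with
  | C a => simpa using hasDerivAt_const t a
  | add p q hp hq =>
    simp only [map_add, add_mul, Finset.sum_add_distrib]
    exact hp.add hq
  | mul_X p ij hp =>
    have h1 : HasDerivAt (fun z => matrixPoint (γ z) ij) (V ij.1 ij.2) t := h ij.1 ij.2
    simp only [map_mul, MvPolynomial.eval_X]
    refine (hp.mul h1).congr_deriv (Eq.symm ?_)
    simp only [Derivation.leibniz, MvPolynomial.pderiv_X, smul_eq_mul, map_add, map_mul,
      MvPolynomial.eval_X, add_mul, Finset.sum_add_distrib]
    rw [add_comm]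
    congr 1
    · rw [Finset.sum_mul]
      exact Finset.sum_congr rfl fun _ _ => by ring
    · rw [Finset.sum_eq_single ij]
      · simp
      · intro b _ hb
        simp [hb.symm]
      · simp

theorem hasDerivAt_one_add_smul (X : Matrix (Fin n) (Fin n) ℂ) (t : ℂ) (i j : Fin n) :
    HasDerivAt (fun z : ℂ => (1 + z • X) i j) (X i j) t := by
  simpa using ((hasDerivAt_id t).mul_const (X i j)).const_add ((1 : Matrix _ _ ℂ) i j)

/-- The restriction of a polynomial in the matrix entries to the line `1 + z X`. -/
noncomputable def lineRestriction (X : Matrix (Fin n) (Fin n) ℂ)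
    (p : MvPolynomial (Fin n × Fin n) ℂ) : Polynomial ℂ :=
  MvPolynomial.aeval (fun ij : Fin n × Fin n =>
    Polynomial.C ((1 : Matrix (Fin n) (Fin n) ℂ) ij.1 ij.2) +
      Polynomial.X * Polynomial.C (X ij.1 ij.2)) p

theorem eval_lineRestriction (X : Matrix (Fin n) (Fin n) ℂ)
    (p : MvPolynomial (Fin n × Fin n) ℂ) (z : ℂ) :
    (lineRestriction X p).eval z = MvPolynomial.eval (matrixPoint (1 + z • X)) p := by
  induction p using MvPolynomial.induction_on with
  | C a => simp [lineRestriction]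
  | add p q hp hq => simp_all [lineRestriction]
  | mul_X p ij hp => simp_all [lineRestriction, matrixPoint, mul_comm z]

/-- A polynomial vanishing at infinitely many points of the line `1 + z X` has a differential at
`1` which kills `X`. -/
theorem differential_eq_zero_of_infinite {X : Matrix (Fin n) (Fin n) ℂ}
    {p : MvPolynomial (Fin n × Fin n) ℂ}
    (h : {z : ℂ | MvPolynomial.eval (matrixPoint (1 + z • X)) p = 0}.Infinite) :
    ∑ ij : Fin n × Fin n,
      MvPolynomial.eval (matrixPoint 1) (MvPolynomial.pderiv ij p) * X ij.1 ij.2 = 0 := by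
  have h0 : lineRestriction X p = 0 := by
    apply Polynomial.eq_zero_of_infinite_isRoot
    refine h.mono fun z hz => ?_
    simpa [Polynomial.IsRoot, eval_lineRestriction] using hz
  have h1 : (fun z : ℂ => MvPolynomial.eval (matrixPoint (1 + z • X)) p) = fun _ => 0 := by
    funext z
    rw [← eval_lineRestriction, h0, Polynomial.eval_zero]
  have h2 := hasDerivAt_eval_matrixPoint p (hasDerivAt_one_add_smul X 0)
  rw [h1, zero_smul, add_zero] at h2
  exact h2.unique (hasDerivAt_const _ _)

theorem mem_groupIdeal {G : Subgroup (GL (Fin n) ℂ)} {p : MvPolynomial (Fin n × Fin n) ℂ} :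
    p ∈ groupIdeal G ↔ ∀ g ∈ G, MvPolynomial.eval (matrixPoint g.val) p = 0 := by
  simp [groupIdeal, MvPolynomial.mem_vanishingIdeal_iff, MvPolynomial.aeval_eq_eval]

theorem mem_groupTangentSpace {G : Subgroup (GL (Fin n) ℂ)} {X : Matrix (Fin n) (Fin n) ℂ} :
    X ∈ groupTangentSpace G ↔ ∀ p ∈ groupIdeal G, ∑ ij : Fin n × Fin n,
      MvPolynomial.eval (matrixPoint 1) (MvPolynomial.pderiv ij p) * X ij.1 ij.2 = 0 :=
  Iff.rfl

end Curves

/-! ### Algebraic groups of the form 1 + g. -/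

section AssociativeAlgebras

variable {n : ℕ}

/-- The invertible matrices in `1 + g`, where `g` is a space of matrices closed under products. -/
def oneAddSubgroup (g : Submodule ℂ (Matrix (Fin n) (Fin n) ℂ))
    (hg : ∀ A ∈ g, ∀ B ∈ g, A * B ∈ g) : Subgroup (GL (Fin n) ℂ) where
  carrier := {x | x.val - 1 ∈ g}
  one_mem' := by simp
  mul_mem' := by
    intro a b ha hb
    have : (a * b).val - 1 = (a.val - 1) * (b.val - 1) + (a.val - 1) + (b.val - 1) := by
      rw [Units.val_mul]
      noncomm_ring
    simp only [Set.mem_ofPred_eq, this]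
    exact g.add_mem (g.add_mem (hg _ ha _ hb) ha) hb
  inv_mem' := by
    intro a ha
    have hmul : ∀ B ∈ g, a.val * B ∈ g := fun B hB => by
      have : a.val * B = (a.val - 1) * B + B := by noncomm_ring
      rw [this]
      exact g.add_mem (hg _ ha _ hB) hB
    -- Left multiplication by `a` is injective on the finite-dimensional space `g`, hence onto:
    -- solving a b = a - 1 in `g` gives a⁻¹ = 1 - b.
    let L : g →ₗ[ℂ] g := (LinearMap.mulLeft ℂ a.val).restrict hmul
    have hL : Function.Injective L := by
      intro x y hxy
      have h : a.val * x.val = a.val * y.val := congrArg Subtype.val hxy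
      exact Subtype.ext (a.isUnit.mul_left_cancel h)
    obtain ⟨b, hb⟩ := LinearMap.injective_iff_surjective.mp hL ⟨_, ha⟩
    have hb' : a.val * b.val = a.val - 1 := congrArg Subtype.val hb
    have : (a⁻¹).val - 1 = -b.val := by
      have h : b.val = (a⁻¹).val * (a.val - 1) := by
        rw [← hb', ← mul_assoc, Units.inv_mul, one_mul]
      rw [h, mul_sub, Units.inv_mul, mul_one, neg_sub]
    simp only [Set.mem_ofPred_eq, this]
    exact g.neg_mem b.2

theorem mem_oneAddSubgroup {g : Submodule ℂ (Matrix (Fin n) (Fin n) ℂ)}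
    {hg : ∀ A ∈ g, ∀ B ∈ g, A * B ∈ g} {x : GL (Fin n) ℂ} :
    x ∈ oneAddSubgroup g hg ↔ x.val - 1 ∈ g :=
  Iff.rfl

/-- The inhomogeneous linear polynomial `A ↦ ℓ (A - 1)`. -/
noncomputable def shiftedLinearForm (l : Module.Dual ℂ (Matrix (Fin n) (Fin n) ℂ)) :
    MvPolynomial (Fin n × Fin n) ℂ :=
  ∑ ij : Fin n × Fin n, MvPolynomial.C (l (Matrix.single ij.1 ij.2 1)) * MvPolynomial.X ij -
    MvPolynomial.C (l 1)

theorem sum_dual_single (l : Module.Dual ℂ (Matrix (Fin n) (Fin n) ℂ))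
    (A : Matrix (Fin n) (Fin n) ℂ) :
    ∑ ij : Fin n × Fin n, l (Matrix.single ij.1 ij.2 1) * A ij.1 ij.2 = l A := by
  conv_rhs => rw [Matrix.matrix_eq_sum_single A]
  rw [Fintype.sum_prod_type]
  simp only [map_sum]
  refine Finset.sum_congr rfl fun i _ => Finset.sum_congr rfl fun j _ => ?_
  have : Matrix.single i j (A i j) = A i j • Matrix.single i j (1 : ℂ) := by
    simp [Matrix.smul_single]
  rw [this, map_smul, smul_eq_mul, mul_comm]

theorem eval_shiftedLinearForm (l : Module.Dual ℂ (Matrix (Fin n) (Fin n) ℂ))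
    (A : Matrix (Fin n) (Fin n) ℂ) :
    MvPolynomial.eval (matrixPoint A) (shiftedLinearForm l) = l (A - 1) := by
  rw [map_sub, ← sum_dual_single l A]
  simp [shiftedLinearForm, matrixPoint]

theorem differential_shiftedLinearForm (l : Module.Dual ℂ (Matrix (Fin n) (Fin n) ℂ))
    (X : Matrix (Fin n) (Fin n) ℂ) :
    ∑ ij : Fin n × Fin n, MvPolynomial.eval (matrixPoint 1)
      (MvPolynomial.pderiv ij (shiftedLinearForm l)) * X ij.1 ij.2 = l X := by
  have h := hasDerivAt_eval_matrixPoint (shiftedLinearForm l) (hasDerivAt_one_add_smul X 0)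
  simp only [eval_shiftedLinearForm, zero_smul, add_zero, add_sub_cancel_left, map_smul,
    smul_eq_mul] at h
  simpa using h.unique ((hasDerivAt_id (0 : ℂ)).mul_const (l X))

/-- A linear Lie algebra closed under matrix products is algebraic. -/
theorem isAlgebraicLie_of_mul_mem (g : LieSubalgebra ℂ (Matrix (Fin n) (Fin n) ℂ))
    (hg : ∀ A ∈ g, ∀ B ∈ g, A * B ∈ g) : IsAlgebraicLie g := by
  refine ⟨oneAddSubgroup g.toSubmodule hg, ⟨Ideal.span
    (shiftedLinearForm '' {l | l ∈ g.toSubmodule.dualAnnihilator}), fun x => ?_⟩, ?_⟩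
  · rw [mem_oneAddSubgroup, ← Subspace.forall_mem_dualAnnihilator_apply_eq_zero_iff,
      MvPolynomial.zeroLocus_span]
    simp [MvPolynomial.aeval_eq_eval, eval_shiftedLinearForm]
  · ext X
    rw [mem_groupTangentSpace]
    constructor
    · intro hX p hp
      apply differential_eq_zero_of_infinite
      -- det(1 + zX) is a polynomial in z with value 1 at z = 0, so all but finitely many points of
      -- the line lie in the group.
      have hfin : {z : ℂ | (1 + z • X).det = 0}.Finite := by
        have hdet : ∀ z : ℂ,
            (lineRestriction X (Matrix.mvPolynomialX (Fin n) (Fin n) ℂ).det).eval z =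
              (1 + z • X).det := fun z => by
          rw [eval_lineRestriction, RingHom.map_det]
          exact congrArg Matrix.det (Matrix.mvPolynomialX_mapMatrix_eval _)
        have h0 : lineRestriction X (Matrix.mvPolynomialX (Fin n) (Fin n) ℂ).det ≠ 0 := by
          intro h
          simpa [h] using hdet 0
        refine (Polynomial.finite_setOfPred_isRoot h0).subset fun z hz => ?_
        simpa [Polynomial.IsRoot, hdet] using hz
      refine hfin.infinite_compl.mono fun z hz => ?_
      have hu : IsUnit (1 + z • X) := (Matrix.isUnit_iff_isUnit_det _).2 (isUnit_iff_ne_zero.2 hz)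
      obtain ⟨u, hu⟩ := hu
      have := mem_groupIdeal.1 hp u (by
        rw [mem_oneAddSubgroup, hu, add_sub_cancel_left]
        exact g.toSubmodule.smul_mem z hX)
      rwa [hu] at this
    · intro hX
      rw [← Subspace.forall_mem_dualAnnihilator_apply_eq_zero_iff]
      intro l hl
      rw [← differential_shiftedLinearForm]
      apply hX
      rw [mem_groupIdeal]
      intro x hx
      rw [eval_shiftedLinearForm]
      exact (Submodule.mem_dualAnnihilator _).1 hl _ hx

end AssociativeAlgebras

/-! ### One-parameter subgroups and nilpotent parts. -/

section OneParameterSubgroups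

variable {n : ℕ}

/-- The left-invariant derivation attached to `X`: the differential of `p` at `g` applied to
`g X`. -/
noncomputable def leftInvariantDeriv (X : Matrix (Fin n) (Fin n) ℂ)
    (p : MvPolynomial (Fin n × Fin n) ℂ) : MvPolynomial (Fin n × Fin n) ℂ :=
  ∑ ij : Fin n × Fin n, MvPolynomial.pderiv ij p *
    ∑ k, MvPolynomial.X (ij.1, k) * MvPolynomial.C (X k ij.2)

theorem eval_leftInvariantDeriv (X A : Matrix (Fin n) (Fin n) ℂ)
    (p : MvPolynomial (Fin n × Fin n) ℂ) :
    MvPolynomial.eval (matrixPoint A) (leftInvariantDeriv X p) = ∑ ij : Fin n × Fin n,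
      MvPolynomial.eval (matrixPoint A) (MvPolynomial.pderiv ij p) * (A * X) ij.1 ij.2 := by
  simp [leftInvariantDeriv, Matrix.mul_apply, matrixPoint]

/-- The left translate `A ↦ p (B A)`. -/
noncomputable def leftTranslate (B : Matrix (Fin n) (Fin n) ℂ)
    (p : MvPolynomial (Fin n × Fin n) ℂ) : MvPolynomial (Fin n × Fin n) ℂ :=
  MvPolynomial.bind₁ (fun ij : Fin n × Fin n =>
    ∑ k, MvPolynomial.C (B ij.1 k) * MvPolynomial.X (k, ij.2)) p

theorem eval_leftTranslate (A B : Matrix (Fin n) (Fin n) ℂ)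
    (p : MvPolynomial (Fin n × Fin n) ℂ) :
    MvPolynomial.eval (matrixPoint A) (leftTranslate B p) =
      MvPolynomial.eval (matrixPoint (B * A)) p := by
  induction p using MvPolynomial.induction_on with
  | C a => simp [leftTranslate]
  | add p q hp hq => simp_all [leftTranslate]
  | mul_X p ij hp => simp_all [leftTranslate, matrixPoint, Matrix.mul_apply]

theorem leftInvariantDeriv_mem_groupIdeal {G : Subgroup (GL (Fin n) ℂ)}
    {X : Matrix (Fin n) (Fin n) ℂ} (hX : X ∈ groupTangentSpace G)
    {p : MvPolynomial (Fin n × Fin n) ℂ} (hp : p ∈ groupIdeal G) :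
    leftInvariantDeriv X p ∈ groupIdeal G := by
  rw [mem_groupIdeal] at hp ⊢
  intro g hg
  -- Translation moves tangency from 1 to g: the differential of the translate at 1 along X is that
  -- of `p` at g along gX.
  have hq : leftTranslate g.val p ∈ groupIdeal G := mem_groupIdeal.2 fun x hx => by
    rw [eval_leftTranslate]
    exact hp (g * x) (G.mul_mem hg hx)
  have h1 := hasDerivAt_eval_matrixPoint (leftTranslate g.val p) (hasDerivAt_one_add_smul X 0)
  rw [zero_smul, add_zero, mem_groupTangentSpace.1 hX _ hq] at h1
  have hline : ∀ i j, HasDerivAt (fun z : ℂ => (g.val * (1 + z • X)) i j)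
      ((g.val * X) i j) 0 := fun i j => by
    have := ((hasDerivAt_id (0 : ℂ)).mul_const ((g.val * X) i j)).const_add (g.val i j)
    simpa [mul_add] using this
  have h2 := hasDerivAt_eval_matrixPoint p hline
  simp only [zero_smul, add_zero, mul_one] at h2
  rw [eval_leftInvariantDeriv]
  simp only [eval_leftTranslate] at h1
  exact h2.unique h1

/-- A polynomial vanishing on `G` vanishes on the one-parameter subgroup generated by an element
of the Lie algebra of `G`. -/
theorem eval_curve_eq_zero {G : Subgroup (GL (Fin n) ℂ)} {X : Matrix (Fin n) (Fin n) ℂ}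
    (hX : X ∈ groupTangentSpace G) {γ : ℂ → Matrix (Fin n) (Fin n) ℂ} (h0 : γ 0 = 1)
    (hγ : ∀ t i j, HasDerivAt (fun z => γ z i j) ((γ t * X) i j) t)
    {p : MvPolynomial (Fin n × Fin n) ℂ} (hp : p ∈ groupIdeal G) (t : ℂ) :
    MvPolynomial.eval (matrixPoint (γ t)) p = 0 := by
  have hd : ∀ (q : MvPolynomial (Fin n × Fin n) ℂ) (t : ℂ),
      HasDerivAt (fun z => MvPolynomial.eval (matrixPoint (γ z)) q)
        (MvPolynomial.eval (matrixPoint (γ t)) (leftInvariantDeriv X q)) t := fun q t => by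
    rw [eval_leftInvariantDeriv]
    exact hasDerivAt_eval_matrixPoint q (hγ t)
  -- Each derivative along the curve replaces `q` by another member of the ideal, which vanishes at
  -- γ(0) = 1. The Taylor series at 0 of this entire function is therefore zero.
  have hiter : ∀ (k : ℕ) (q : MvPolynomial (Fin n × Fin n) ℂ), q ∈ groupIdeal G →
      iteratedDeriv k (fun z => MvPolynomial.eval (matrixPoint (γ z)) q) 0 = 0 := by
    intro k
    induction k with
    | zero =>
      intro q hq
      rw [iteratedDeriv_zero, h0]
      exact mem_groupIdeal.1 hq 1 G.one_mem
    | succ k ih =>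
      intro q hq
      rw [iteratedDeriv_succ', show deriv (fun z => MvPolynomial.eval (matrixPoint (γ z)) q) = _
        from funext fun t => (hd q t).deriv]
      exact ih _ (leftInvariantDeriv_mem_groupIdeal hX hq)
  have := Complex.taylorSeries_eq_of_entire'
    (f := fun z => MvPolynomial.eval (matrixPoint (γ z)) p) 0 t
    (fun t => (hd p t).differentiableAt)
  simpa [hiter _ p hp] using this.symm

/-- The nilpotent part of `S + N` is tangent to every group to which `S + N` is tangent. -/
theorem nilpotent_part_mem_groupTangentSpace {G : Subgroup (GL (Fin n) ℂ)}
    {S N : Matrix (Fin n) (Fin n) ℂ} (hSS : S * S = (2 : ℂ) • S) (hSN : S * N = 0)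
    (hNS : N * S = 0) (hNN : N * N = 0) (h : S + N ∈ groupTangentSpace G) :
    N ∈ groupTangentSpace G := by
  rw [mem_groupTangentSpace]
  intro p hp
  -- Closed form of exp(t(S + N)), using S² = 2S and the vanishing of the other products.
  let γ : ℂ → Matrix (Fin n) (Fin n) ℂ := fun t =>
    1 + ((Complex.exp (2 * t) - 1) / 2) • S + t • N
  have hγ : ∀ t i j, HasDerivAt (fun z => γ z i j) ((γ t * (S + N)) i j) t := by
    intro t i j
    have hmul : γ t * (S + N) = Complex.exp (2 * t) • S + N := by
      simp only [γ, add_mul, mul_add, one_mul, smul_mul_assoc, hSS, hSN, hNS, hNN, smul_zero,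
        add_zero, smul_smul]
      module
    rw [hmul]
    have he : HasDerivAt (fun z : ℂ => (Complex.exp (2 * z) - 1) / 2) (Complex.exp (2 * t)) t := by
      have := ((((hasDerivAt_id t).const_mul 2).cexp).sub_const 1).div_const 2
      exact this.congr_deriv (by simp)
    have := ((he.mul_const (S i j)).const_add ((1 : Matrix (Fin n) (Fin n) ℂ) i j)).add
      ((hasDerivAt_id t).mul_const (N i j))
    refine (this.congr_deriv (by simp)).congr_of_eventuallyEq (Filter.Eventually.of_forall ?_)
    intro z
    simp [γ]
  have hz := fun t => eval_curve_eq_zero h (γ := γ) (by simp [γ]) hγ hp t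
  apply differential_eq_zero_of_infinite
  -- At t = kπi one has exp(2t) = 1, so the `S` term vanishes and γ(t) = 1 + tN.
  have hinj : Function.Injective fun k : ℕ => (k : ℂ) * (Real.pi * Complex.I) := by
    intro a b hab
    have hpi : (Real.pi : ℂ) * Complex.I ≠ 0 :=
      mul_ne_zero (Complex.ofReal_ne_zero.2 Real.pi_ne_zero) Complex.I_ne_zero
    exact_mod_cast mul_right_cancel₀ hpi hab
  refine (Set.infinite_range_of_injective hinj).mono ?_
  rintro _ ⟨k, rfl⟩
  have hk := hz ((k : ℂ) * (Real.pi * Complex.I))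
  have hexp : Complex.exp (2 * ((k : ℂ) * (Real.pi * Complex.I))) = 1 := by
    rw [show 2 * ((k : ℂ) * (Real.pi * Complex.I)) = k * (2 * Real.pi * Complex.I) by ring]
    exact Complex.exp_nat_mul_two_pi_mul_I k
  simpa [γ, hexp] using hk

end OneParameterSubgroups

/-! ### The algebras h and m. -/

section TheAlgebras

variable (α β : ℂ)

/-- The nilpotent matrix by which `X₄` differs from an element of `h_{α,β}`. -/
noncomputable def nilMat : Matrix (Fin 4) (Fin 4) ℂ :=
  !![0, 0, 0, 0;
     0, 0, 0, 0;
     -1 / 2, 1 / 2, 0, 0;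
     0, 0, 0, 0]

theorem hMat_eq_matX₄_add_nilMat :
    hMat α β (1 / 2) (1 / 2) ((α + β) / 4) = matX₄ α β + nilMat := by
  ext i j
  fin_cases i <;> fin_cases j <;> simp [hMat, matX₄, nilMat] <;> ring

theorem mMat_eq_hMat_add (x₁ x₂ x₃ x₄ : ℂ) :
    mMat α β x₁ x₂ x₃ x₄ = hMat α β x₁ x₂ x₃ + x₄ • matX₄ α β := by
  ext i j
  fin_cases i <;> fin_cases j <;> simp [hMat, matX₄, mMat] <;> ring

theorem matX₄_mul_self : matX₄ α β * matX₄ α β = (2 : ℂ) • matX₄ α β := by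
  ext i j
  fin_cases i <;> fin_cases j <;> simp [matX₄, Matrix.mul_apply, Fin.sum_univ_four] <;> ring

theorem matX₄_mul_nilMat : matX₄ α β * nilMat = 0 := by
  ext i j
  fin_cases i <;> fin_cases j <;> simp [matX₄, nilMat, Matrix.mul_apply, Fin.sum_univ_four]

theorem nilMat_mul_matX₄ : nilMat * matX₄ α β = 0 := by
  ext i j
  fin_cases i <;> fin_cases j <;>
    simp [matX₄, nilMat, Matrix.mul_apply, Fin.sum_univ_four] <;> ring

theorem nilMat_mul_self : nilMat * nilMat = 0 := by
  ext i j
  fin_cases i <;> fin_cases j <;> simp [nilMat, Matrix.mul_apply, Fin.sum_univ_four]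

theorem mem_hAlg {A : Matrix (Fin 4) (Fin 4) ℂ} :
    A ∈ hAlg α β ↔ ∃ x₁ x₂ x₃ : ℂ, A = hMat α β x₁ x₂ x₃ :=
  Iff.rfl

theorem mem_mAlg {A : Matrix (Fin 4) (Fin 4) ℂ} :
    A ∈ mAlg α β ↔ ∃ x₁ x₂ x₃ x₄ : ℂ, A = mMat α β x₁ x₂ x₃ x₄ :=
  Iff.rfl

theorem mAlg_mul_mem : ∀ A ∈ mAlg α β, ∀ B ∈ mAlg α β, A * B ∈ mAlg α β := by
  rintro _ ⟨x₁, x₂, x₃, x₄, rfl⟩ _ ⟨y₁, y₂, y₃, y₄, rfl⟩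
  -- With s = x₁ + x₂ + x₄ and s' = y₁ + y₂ + y₄, the upper left block of the product has entries
  -- 2ss', which is the X₄ coordinate. The third coordinate is the last entry of row three minus the
  -- share (α + β)/4 · 2ss' of X₄.
  refine ⟨0, 0, (α * x₁ + (β - 1) * x₂ + (α + β) / 2 * x₄) * (y₁ + y₄ / 2) +
    (β * x₁ + (α + 1) * x₂ + (α + β) / 2 * x₄) * (y₂ + y₄ / 2) -
      (α + β) / 2 * (x₁ + x₂ + x₄) * (y₁ + y₂ + y₄),
    2 * (x₁ + x₂ + x₄) * (y₁ + y₂ + y₄), ?_⟩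
  ext i j
  fin_cases i <;> fin_cases j <;> simp [mMat, Matrix.mul_apply, Fin.sum_univ_four] <;> ring

theorem isAlgebraicLie_mAlg : IsAlgebraicLie (mAlg α β) :=
  isAlgebraicLie_of_mul_mem _ (mAlg_mul_mem α β)

theorem mAlg_eq_sup :
    (mAlg α β).toSubmodule = (hAlg α β).toSubmodule ⊔ Submodule.span ℂ {matX₄ α β} := by
  ext A
  simp only [Submodule.mem_sup, Submodule.mem_span_singleton, LieSubalgebra.mem_toSubmodule,
    mem_mAlg, mem_hAlg, mMat_eq_hMat_add]
  constructor
  · rintro ⟨x₁, x₂, x₃, x₄, rfl⟩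
    exact ⟨_, ⟨x₁, x₂, x₃, rfl⟩, _, ⟨x₄, rfl⟩, rfl⟩
  · rintro ⟨_, ⟨x₁, x₂, x₃, rfl⟩, _, ⟨x₄, rfl⟩, rfl⟩
    exact ⟨x₁, x₂, x₃, x₄, rfl⟩

theorem mMat_eq_zero {x₁ x₂ x₃ x₄ : ℂ} (h : mMat α β x₁ x₂ x₃ x₄ = 0) :
    x₁ = 0 ∧ x₂ = 0 ∧ x₃ = 0 ∧ x₄ = 0 := by
  have h1 : x₁ + x₄ / 2 = 0 := by simpa [mMat] using congrFun (congrFun h 0) 3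
  have h2 : x₂ + x₄ / 2 = 0 := by simpa [mMat] using congrFun (congrFun h 1) 3
  have h3 : x₃ + (α + β) / 4 * x₄ = 0 := by simpa [mMat] using congrFun (congrFun h 2) 3
  have h4 : α * x₁ + (β - 1) * x₂ + (α + β) / 2 * x₄ = 0 := by
    simpa [mMat] using congrFun (congrFun h 2) 0
  -- The `-1` in β - 1 matters: eliminating x₁ and x₂ from `h4` leaves x₄/2, whatever α and β are.
  have e4 : x₄ = 0 := by linear_combination 2 * h4 - 2 * α * h1 - 2 * (β - 1) * h2
  subst e4
  exact ⟨by simpa using h1, by simpa using h2, by simpa using h3, rfl⟩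

theorem disjoint_hAlg_span :
    Disjoint (hAlg α β).toSubmodule (Submodule.span ℂ {matX₄ α β}) := by
  rw [Submodule.disjoint_def]
  intro A hA hA'
  obtain ⟨x₁, x₂, x₃, rfl⟩ := hA
  obtain ⟨c, hc⟩ := Submodule.mem_span_singleton.1 hA'
  have h := mMat_eq_zero α β (x₁ := x₁) (x₂ := x₂) (x₃ := x₃) (x₄ := -c) (by
    rw [mMat_eq_hMat_add, ← hc, ← add_smul, add_neg_cancel, zero_smul])
  rw [← hc, neg_eq_zero.1 h.2.2.2, zero_smul]

/-- The parametrization of `m` by its four coordinates. -/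
noncomputable def mParam : (Fin 4 → ℂ) →ₗ[ℂ] mAlg α β where
  toFun x := ⟨mMat α β (x 0) (x 1) (x 2) (x 3), _, _, _, _, rfl⟩
  map_add' x y := by
    apply Subtype.ext
    ext i j
    fin_cases i <;> fin_cases j <;> simp [mMat] <;> ring
  map_smul' c x := by
    apply Subtype.ext
    ext i j
    fin_cases i <;> fin_cases j <;> simp [mMat] <;> ring

theorem mParam_bijective : Function.Bijective (mParam α β) := by
  constructor
  · rw [injective_iff_map_eq_zero]
    intro x hx
    obtain ⟨h0, h1, h2, h3⟩ := mMat_eq_zero α β (congrArg Subtype.val hx)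
    ext i
    fin_cases i <;> assumption
  · rintro ⟨_, x₁, x₂, x₃, x₄, rfl⟩
    exact ⟨![x₁, x₂, x₃, x₄], rfl⟩

theorem finrank_mAlg : Module.finrank ℂ (mAlg α β) = 4 := by
  rw [← (LinearEquiv.ofBijective _ (mParam_bijective α β)).finrank_eq]
  simp

theorem hAlg_le_mAlg : hAlg α β ≤ mAlg α β := by
  rintro _ ⟨x₁, x₂, x₃, rfl⟩
  exact ⟨x₁, x₂, x₃, 0, by simp [mMat_eq_hMat_add]⟩

theorem mAlg_le_of_isAlgebraicLie {g : LieSubalgebra ℂ (Matrix (Fin 4) (Fin 4) ℂ)}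
    (hg : IsAlgebraicLie g) (h : hAlg α β ≤ g) : mAlg α β ≤ g := by
  obtain ⟨G, -, hG⟩ := hg
  have hX : matX₄ α β + nilMat ∈ g := by
    rw [← hMat_eq_matX₄_add_nilMat]
    exact h ⟨_, _, _, rfl⟩
  have hN : nilMat ∈ g := by
    rw [← LieSubalgebra.mem_toSubmodule, hG] at hX ⊢
    exact nilpotent_part_mem_groupTangentSpace (matX₄_mul_self α β) (matX₄_mul_nilMat α β)
      (nilMat_mul_matX₄ α β) nilMat_mul_self hX
  have h4 : matX₄ α β ∈ g := by simpa using g.sub_mem hX hN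
  rintro _ ⟨x₁, x₂, x₃, x₄, rfl⟩
  rw [mMat_eq_hMat_add]
  exact g.add_mem (h ⟨_, _, _, rfl⟩) (g.smul_mem _ h4)

/-- X₄ commutes with all of m, so the fourth coordinates drop out. -/
theorem lie_mMat (x₁ x₂ x₃ x₄ y₁ y₂ y₃ y₄ : ℂ) :
    ⁅mMat α β x₁ x₂ x₃ x₄, mMat α β y₁ y₂ y₃ y₄⁆ = ⁅hMat α β x₁ x₂ x₃, hMat α β y₁ y₂ y₃⁆ := by
  rw [Ring.lie_def, Ring.lie_def]
  ext i j
  fin_cases i <;> fin_cases j <;> simp [mMat, hMat] <;> ring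

theorem derivedSpan_mAlg : derivedSpan (mAlg α β) = derivedSpan (hAlg α β) := by
  apply le_antisymm
  · apply Submodule.span_mono
    rintro _ ⟨_, ⟨x₁, x₂, x₃, x₄, rfl⟩, _, ⟨y₁, y₂, y₃, y₄, rfl⟩, rfl⟩
    exact ⟨_, ⟨x₁, x₂, x₃, rfl⟩, _, ⟨y₁, y₂, y₃, rfl⟩, (lie_mMat ..).symm⟩
  · apply Submodule.span_mono
    rintro _ ⟨X, hX, Y, hY, rfl⟩
    exact ⟨X, hAlg_le_mAlg α β hX, Y, hAlg_le_mAlg α β hY, rfl⟩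

end TheAlgebras


theorem mainTheorem6 (α β : ℂ) :
    -- `m` is the four-dimensional Lie algebra `h_{α,β} ⊕ ℂ X₄`
    (mAlg α β).toSubmodule = (hAlg α β).toSubmodule ⊔ Submodule.span ℂ {matX₄ α β} ∧
    Disjoint (hAlg α β).toSubmodule (Submodule.span ℂ {matX₄ α β}) ∧
    Module.finrank ℂ (mAlg α β) = 4 ∧
    -- `m` is algebraic
    IsAlgebraicLie (mAlg α β) ∧
    -- `m` is the algebraic Lie algebra generated by `h_{α,β}`: the smallest algebraic Lie algebra
    -- containing it, with the same derived algebra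
    IsLeast {g : LieSubalgebra ℂ (Matrix (Fin 4) (Fin 4) ℂ) | IsAlgebraicLie g ∧ hAlg α β ≤ g}
      (mAlg α β) ∧
    derivedSpan (mAlg α β) = derivedSpan (hAlg α β) ∧
    -- `m` contains the replicas of all its elements
    (∀ X ∈ mAlg α β, ∀ Y : Matrix (Fin 4) (Fin 4) ℂ, IsReplica X Y → Y ∈ mAlg α β) := by
  refine ⟨mAlg_eq_sup α β, disjoint_hAlg_span α β, finrank_mAlg α β, isAlgebraicLie_mAlg α β,
    ⟨⟨isAlgebraicLie_mAlg α β, hAlg_le_mAlg α β⟩, fun g hg => ?_⟩, derivedSpan_mAlg α β,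
    fun X hX Y hY => hY _ (isAlgebraicLie_mAlg α β) hX⟩
  exact mAlg_le_of_isAlgebraicLie α β hg.1 hg.2
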